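/- Let $\mathcal E\subset J^\infty(2,1)$ be the infinite prolongation of the equation $$u_{yy}=(u_x+x)u_{xy}-(u_{xx}+2)u_y .$$ For $p\in\mathbb Z$ put $r^p_i=0$ for $i<-2$, $r^p_{-2}=1$ and consider the system $$r^p_{i,x}=(u_x+x)\,r^p_{i-1,x}-r^p_{i-1,y}-(p+i+3)\,r^p_{i-1},\qquad r^p_{i,y}=u_y\,r^p_{i-1,x}\qquad(i\ge -1).\tag{1}$$ If $p\ne-2$, take $r^p_{-1}=-(p+2)x$ and $r^p_0=-(p+2)u+\tfrac12(p+2)^2x^2$, and let $\rho^p$ be the system (1) for $i\ge1$, with the nonlocal variables $r^p_1,r^p_2,\dots$. If $p=-2$, equations (1) say that $r^{-2}_{-1}$ is a constant; normalize it to $r^{-2}_{-1}=1$, take $r^{-2}_0=-x$, $r^{-2}_1=-u+\tfrac12x^2$, and let $\rho^{-2}$ be the system (1) for $i\ge2$, with the nonlocal variables $r^{-2}_2,r^{-2}_3,\dots$. Two coverings $\tau_1:\tilde{\mathcal E}^1\to\mathcal E$, $\tau_2:\tilde{\mathcal E}^2\to\mathcal E$ are called equivalent if there is a diffeomorphism $F:\tilde{\mathcal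 E}^1\to\tilde{\mathcal E}^2$ with $\tau_2\circ F=\tau_1$ and $F_*(\tilde D^1_i)=\sum_j\mu_i^j\tilde D^2_j$ for some smooth functions $\mu_i^j$ on $\tilde{\mathcal E}^2$, where $\tilde D^l_i$ are the total derivatives on $\tilde{\mathcal E}^l$. **Proposition.** Every $\rho^p$ is a covering of $\mathcal E$ (that is, the lifted total derivatives $\tilde D_x,\tilde D_y$ commute), and (1) holds in it for all $i\ge-1$. All the coverings $\rho^p$, $p\in\mathbb Z$, are pairwise equivalent. More precisely: 1. Let $\mathcal Z=\sum_{i\ge-1}(i+2)\,r_{i+1}\,\partial/\partial r_i$, acting on polynomials in the independent variables $r_{-1},r_0,r_1,\dots$, and define $$Q_{i,0}=\frac{r_{-1}^{\,i+2}}{(i+2)!},\qquad Q_{i,j}=\frac1j\,\mathcal Z(Q_{i,j-1})\quad(i\ge0,\ j\ge1).$$ Let $Q^{-3}_{i,j}$ be the value of $Q_{i,j}$ at $r_k=r_k^{-3}$, $k\ge-1$, and let $$d_i=\sum_{k=0}^{i}(-1)^k\Big(\prod_{l=1}^{k}(p+3+l)\Big)\,Q^{-3}_{k,i-k}\qquad(i\ge-1),$$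 so that $d_{-1}=0$. If $p\neq-2$, there is an equivalence from $\rho^{-3}$ to $\rho^p$ under which $$r^p_i=-(p+2)\big(r^{-3}_i-(p+3)\,d_i\big)\qquad\text{for all } i\ge-1.$$ 2. The covering $\rho^{-2}$ coincides with $\rho^{-1}$: $r^{-2}_{i+1}=r^{-1}_i$ for all $i\ge-2$, with the same defining equations. -/

import Mathlib

open scoped ContDiff

noncomputable section

namespace RdDym

/-! ### Smooth functions and vector fields on (subsets of) a space with countably many coordinates -/

/-- A smooth function on `ℝ^I` in the sense of infinite jet geometry: it depends on finitely many
coordinates and is a `C^∞` function of these. -/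
def Smooth {I : Type} (f : (I → ℝ) → ℝ) : Prop :=
  ∃ (s : Finset I) (g : (s → ℝ) → ℝ), ContDiff ℝ ∞ g ∧ ∀ θ, f θ = g (fun a => θ a)

/-- A smooth function on `M ⊆ ℝ^I`: the restriction of a smooth function on `ℝ^I`. -/
def SmoothOn {I : Type} (M : Set (I → ℝ)) (f : M → ℝ) : Prop :=
  ∃ g : (I → ℝ) → ℝ, Smooth g ∧ ∀ θ : M, f θ = g θ

/-- The action of the vector field `∑ V_a ∂/∂θ_a` on a function: on a smooth `f` this is the
finite sum `∑ V_a ∂f/∂θ_a`. -/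
def act {I : Type} (V : (I → ℝ) → (I → ℝ)) (f : (I → ℝ) → ℝ) : (I → ℝ) → ℝ :=
  fun θ => lineDeriv ℝ f θ (V θ)

/-! ### The jet space `J^∞(2,1)` and infinitely prolonged equations -/

/-- The coordinates `x`, `y` and `u i j = ∂^{i+j} u / ∂x^i ∂y^j` on `J^∞(2,1)`. -/
inductive Coord : Type
  | x : Coord
  | y : Coord
  | u (i j : ℕ) : Coord

/-- The infinite jet space of functions `u(x,y)`. -/
abbrev Jet : Type := Coord → ℝ

/-- The total derivatives `D_x` (index `0`) and `D_y` (index `1`) on `J^∞(2,1)`. -/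
def totalD (i : Fin 2) (θ : Jet) : Jet
  | .x => if i = 0 then 1 else 0
  | .y => if i = 1 then 1 else 0
  | .u a b => if i = 0 then θ (.u (a + 1) b) else θ (.u a (b + 1))

/-- The infinite prolongation of `F = 0`: all `D_x^a D_y^b F` vanish. -/
def prolong (F : Jet → ℝ) : Set Jet :=
  {θ | ∀ a b : ℕ, ((act (totalD 0))^[a] ((act (totalD 1))^[b] F)) θ = 0}

/-- The infinitely prolonged equation `u_yy = (u_x + x) u_xy - (u_xx + 2) u_y`. -/
def rdEq : Set Jet :=
  prolong fun θ => θ (.u 0 2) -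
    ((θ (.u 1 0) + θ .x) * θ (.u 1 1) - (θ (.u 2 0) + 2) * θ (.u 0 1))

/-! ### Coverings with fibre coordinates `w_0, w_1, …` -/

/-- The points `(θ, w)` of `J^∞(2,1) × ℝ^ℕ`. -/
abbrev Total : Type := Coord ⊕ ℕ → ℝ

/-- The projection to `J^∞(2,1)`. -/
def base (Θ : Total) : Jet := fun a => Θ (Sum.inl a)

/-- The total space `E × ℝ^ℕ` of the trivial bundle over `E`. -/
def overSpace (E : Set Jet) : Set Total := {Θ | base Θ ∈ E}

/-- Right-hand sides of a system `∂w_n/∂x = coef 0 n`, `∂w_n/∂y = coef 1 n`, `n ≥ 0`. -/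
structure NonlocalSystem : Type where
  coef : Fin 2 → ℕ → Total → ℝ

/-- The lifted total derivatives `D̃_i = D_i + ∑ (coef i n) ∂/∂w_n`. -/
def NonlocalSystem.liftD (c : NonlocalSystem) (i : Fin 2) (Θ : Total) : Total :=
  Sum.elim (totalD i (base Θ)) (fun n => c.coef i n Θ)

/-- The system defines a covering of `E`: its right-hand sides are smooth and it is compatible
modulo `E`, that is, `[D̃_x, D̃_y] = 0` on `E × ℝ^ℕ`. (The fields `D̃_i` project to `D_i` by
construction.) -/
def NonlocalSystem.IsCovering (E : Set Jet) (c : NonlocalSystem) : Prop :=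
  (∀ i n, Smooth (c.coef i n)) ∧
  ∀ f : Total → ℝ, Smooth f → ∀ Θ ∈ overSpace E,
    act (c.liftD 0) (act (c.liftD 1) f) Θ = act (c.liftD 1) (act (c.liftD 0) f) Θ

/-- `F` is an equivalence from the covering `c₁` to the covering `c₂` of `E`: a diffeomorphism
over `E` such that `F_* D̃¹_i = ∑_j μ_i^j D̃²_j` with smooth functions `μ_i^j`.
In the last condition `h` is any smooth function that represents `g ∘ F` on `E × ℝ^ℕ`
(there is one since `F` is smooth). -/
structure IsEquivalence (E : Set Jet) (c₁ c₂ : NonlocalSystem)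
    (F : overSpace E ≃ overSpace E) : Prop where
  smooth : ∀ f : overSpace E → ℝ, SmoothOn (overSpace E) f → SmoothOn (overSpace E) (f ∘ F)
  smooth_symm : ∀ f : overSpace E → ℝ, SmoothOn (overSpace E) f →
    SmoothOn (overSpace E) (f ∘ F.symm)
  base_eq : ∀ Θ : overSpace E, base (F Θ : Total) = base (Θ : Total)
  push : ∃ μ : Fin 2 → Fin 2 → overSpace E → ℝ, (∀ i j, SmoothOn (overSpace E) (μ i j)) ∧
    ∀ (i : Fin 2) (g h : Total → ℝ), Smooth g → Smooth h →
      (∀ Θ : overSpace E, h Θ = g (F Θ)) →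
      ∀ Θ : overSpace E,
        act (c₁.liftD i) h Θ = ∑ j : Fin 2, μ i j (F Θ) * act (c₂.liftD j) g (F Θ)

/-- Equivalence of coverings of `E`. -/
def Equivalent (E : Set Jet) (c₁ c₂ : NonlocalSystem) : Prop :=
  ∃ F : overSpace E ≃ overSpace E, IsEquivalence E c₁ c₂ F

/-! ### The coverings `ρ^p` -/

/-- `r p k` is the function `r^p_{k-2}`, `k ≥ 0`. The first ones are local, the others are
the fibre coordinates. For `p = -2` the equation for `r^p_{-1}` says that `r^p_{-1}` is a constant;
this constant is taken to be `1`. -/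
def r (p : ℤ) (k : ℕ) (Θ : Total) : ℝ :=
  if p = -2 then
    match k with
    | 0 => 1
    | 1 => 1
    | 2 => -Θ (.inl .x)
    | 3 => -Θ (.inl (.u 0 0)) + Θ (.inl .x) ^ 2 / 2
    | n + 4 => Θ (.inr n)
  else
    match k with
    | 0 => 1
    | 1 => -(p + 2) * Θ (.inl .x)
    | 2 => -(p + 2) * Θ (.inl (.u 0 0)) + (p + 2) ^ 2 * Θ (.inl .x) ^ 2 / 2
    | n + 3 => Θ (.inr n)

/-- `rDer p k = (r^p_{i,x}, r^p_{i,y})`, `i = k - 2`, as given by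
`r_{i,x} = (u_x + x) r_{i-1,x} - r_{i-1,y} - (p+i+3) r_{i-1}`, `r_{i,y} = u_y r_{i-1,x}`,
starting from `r_i = 0` for `i < -2`. -/
def rDer (p : ℤ) : ℕ → Total → ℝ × ℝ
  | 0, _ => (0, 0)
  | k + 1, Θ =>
    ((Θ (.inl (.u 1 0)) + Θ (.inl .x)) * (rDer p k Θ).1 - (rDer p k Θ).2 - (p + k + 2) * r p k Θ,
      Θ (.inl (.u 0 1)) * (rDer p k Θ).1)

/-- The first index `k` for which `r p k` is a fibre coordinate. -/
def firstNonlocal (p : ℤ) : ℕ := if p = -2 then 4 else 3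

/-- The covering `ρ^p`; its fibre coordinate `w_n` is `r p (n + firstNonlocal p)`. -/
def rho (p : ℤ) : NonlocalSystem where
  coef i n Θ := if i = 0 then (rDer p (n + firstNonlocal p) Θ).1
    else (rDer p (n + firstNonlocal p) Θ).2

/-! ### The quantities `Q_{i,j}` and the transformation -/

/-- The field `Z = ∑_{i ≥ -1} (i+2) r_{i+1} ∂/∂r_i` on polynomials in `r_{-1}, r_0, r_1, …`; the
variable `X k` is `r_{k-1}`. -/
def Z : Derivation ℝ (MvPolynomial ℕ ℝ) (MvPolynomial ℕ ℝ) :=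
  MvPolynomial.mkDerivation ℝ fun k =>
    MvPolynomial.C ((k : ℝ) + 1) * (MvPolynomial.X (k + 1) : MvPolynomial ℕ ℝ)

/-- `Q_{i,0} = r_{-1}^{i+2} / (i+2)!` and `Q_{i,j} = (1/j) Z(Q_{i,j-1})`. -/
def Q (i : ℕ) : ℕ → MvPolynomial ℕ ℝ
  | 0 => MvPolynomial.C (1 / ((i + 2).factorial : ℝ)) * MvPolynomial.X 0 ^ (i + 2)
  | j + 1 => MvPolynomial.C (1 / ((j : ℝ) + 1)) * Z (Q i j)

/-- `d p m = d_i`, `i = m - 1 ≥ -1`, that is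
`d_i = ∑_{k=0}^{i} (-1)^k (p+4)(p+5)⋯(p+k+3) Q_{k,i-k}^{-3}`. -/
def d (p : ℤ) (m : ℕ) (Θ : Total) : ℝ :=
  ∑ k ∈ Finset.range m, (-1) ^ k * (∏ l ∈ Finset.range k, ((p : ℝ) + 4 + l)) *
    MvPolynomial.eval (fun a => r (-3) (a + 1) Θ) (Q k (m - 1 - k))

end RdDym

end

/-! Put R = ∑ r^p_{k-2} λ^k, v = u_x + x and w = u_y. Then (1) reads R_x = λ(v R_x - R_y - λ R_λ -
(p+2) R), R_y = λ w R_x. Apart from -(p+2) R, only derivations act on R, so if R solves the system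
for p = -3 (where the last term is +R), then R^α solves it with +αR, that is, for p = -α-2. Hence
the power -(p+2) of the series of ρ^{-3} is the series of ρ^p (`binomTrunc_system`,
`powCoeff_system`).

The binomial expansion makes this explicit: Z differentiates the generic series with respect to λ,
so Q_{i,j} is a Taylor coefficient of its (i+2)-th power divided by (i+2)! (`Q_eq_coeff`), and the
terms of degree at least two assemble into d_i (`rPow_succ`). As d_i involves only r^{-3}_k with k <
i, the map is triangular, and it is invertible when p ≠ -2 (`exists_globalEquiv`). For p = -2 the
exponent vanishes, but ρ^{-2} is ρ^{-1} with shifted indices (`rho_neg_two`).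

These maps live on all of J^∞ × ℝ^ℕ. Restricting them to the equation requires that total
derivatives be tangent to it (`act_eq_of_eqOn`), since functions on it extend in many ways. The
equation itself enters the compatibility of (1) (`rDer_compatible`). -/

noncomputable section

namespace RdDym

/-! ### Calculus of smooth functions of finitely many coordinates -/

section Calculus

variable {I J : Type}

/-- The restriction of a point to finitely many coordinates. -/
def restr (s : Finset I) (θ : I → ℝ) : s → ℝ := fun a => θ a

theorem Smooth.of_contDiff [Fintype I] {f : (I → ℝ) → ℝ} (hf : ContDiff ℝ ∞ f) : Smooth f := by
  classical
  refine ⟨Finset.univ, fun ξ => f fun a => ξ ⟨a, Finset.mem_univ a⟩, ?_, fun θ => rfl⟩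
  exact hf.comp (contDiff_pi.2 fun a => contDiff_apply ℝ ℝ _)

/-- Only finitely many components of `G` matter, and each reads finitely many coordinates. -/
theorem Smooth.comp {f : (I → ℝ) → ℝ} (hf : Smooth f) {G : (J → ℝ) → (I → ℝ)}
    (hG : ∀ a, Smooth fun Θ => G Θ a) : Smooth fun Θ => f (G Θ) := by
  classical
  obtain ⟨s, g, hg, hfg⟩ := hf
  choose t k hk hGk using hG
  refine ⟨s.biUnion t, fun ξ => g fun a => k a fun b =>
    ξ ⟨b, Finset.mem_biUnion.2 ⟨a, a.2, b.2⟩⟩, ?_, fun Θ => ?_⟩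
  · refine hg.comp (contDiff_pi.2 fun a => (hk a).comp (contDiff_pi.2 fun b => contDiff_apply ℝ ℝ _))
  · change f (G Θ) = _
    rw [hfg]
    congr 1
    funext a
    exact hGk a Θ

theorem Smooth.coord (a : I) : Smooth fun θ : I → ℝ => θ a :=
  ⟨{a}, fun ξ => ξ ⟨a, Finset.mem_singleton_self a⟩, contDiff_apply ℝ ℝ _, fun _ => rfl⟩

theorem Smooth.const (c : ℝ) : Smooth fun _ : I → ℝ => c :=
  ⟨∅, fun _ => c, contDiff_const, fun _ => rfl⟩

theorem Smooth.add {f g : (I → ℝ) → ℝ} (hf : Smooth f) (hg : Smooth g) :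
    Smooth fun θ => f θ + g θ := by
  have h : Smooth fun v : Bool → ℝ => v true + v false := Smooth.of_contDiff (by fun_prop)
  exact h.comp (G := fun θ b => cond b (f θ) (g θ)) (by rintro (_ | _) <;> assumption)

theorem Smooth.mul {f g : (I → ℝ) → ℝ} (hf : Smooth f) (hg : Smooth g) :
    Smooth fun θ => f θ * g θ := by
  have h : Smooth fun v : Bool → ℝ => v true * v false := Smooth.of_contDiff (by fun_prop)
  exact h.comp (G := fun θ b => cond b (f θ) (g θ)) (by rintro (_ | _) <;> assumption)

theorem Smooth.neg {f : (I → ℝ) → ℝ} (hf : Smooth f) : Smooth fun θ => -f θ := by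
  simpa using (Smooth.const (-1)).mul hf

theorem Smooth.sub {f g : (I → ℝ) → ℝ} (hf : Smooth f) (hg : Smooth g) :
    Smooth fun θ => f θ - g θ := by
  simpa [sub_eq_add_neg] using hf.add hg.neg

theorem Smooth.sum {ι : Type} {f : ι → (I → ℝ) → ℝ} (t : Finset ι)
    (hf : ∀ i ∈ t, Smooth (f i)) : Smooth fun θ => ∑ i ∈ t, f i θ := by
  classical
  induction t using Finset.induction_on with
  | empty => simpa using Smooth.const 0
  | insert i t hi ih =>
    simp only [Finset.sum_insert hi]
    exact (hf i (Finset.mem_insert_self i t)).add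
      (ih fun j hj => hf j (Finset.mem_insert_of_mem hj))

theorem Smooth.hasDerivAt {f : (I → ℝ) → ℝ} (hf : Smooth f) (θ v : I → ℝ) :
    HasDerivAt (fun t : ℝ => f (θ + t • v)) (lineDeriv ℝ f θ v) 0 := by
  obtain ⟨s, g, hg, hfg⟩ := hf
  have hd : DifferentiableAt ℝ (fun t : ℝ => f (θ + t • v)) 0 := by
    have : (fun t : ℝ => f (θ + t • v)) = g ∘ fun t : ℝ => restr s θ + t • restr s v := by
      funext t
      exact hfg _
    rw [this]
    exact (hg.differentiable (by simp)).differentiableAt.comp _ (by fun_prop)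
  exact hd.hasDerivAt

/-- The bridge to finite-dimensional calculus, where the chain rule and the symmetry of second
derivatives are available. -/
theorem lineDeriv_eq_fderiv {s : Finset I} {f : (I → ℝ) → ℝ} {g : (s → ℝ) → ℝ}
    (hg : ContDiff ℝ ∞ g) (hfg : ∀ θ, f θ = g fun a => θ a) (θ v : I → ℝ) :
    lineDeriv ℝ f θ v = fderiv ℝ g (restr s θ) (restr s v) := by
  have h1 : HasFDerivAt g (fderiv ℝ g (restr s θ)) (restr s θ + (0 : ℝ) • restr s v) := by
    simpa using ((hg.differentiable (by simp)) (restr s θ)).hasFDerivAt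
  have h2 : HasDerivAt (fun t : ℝ => restr s θ + t • restr s v) (restr s v) 0 := by
    simpa using ((hasDerivAt_id (0 : ℝ)).smul_const (restr s v)).const_add (restr s θ)
  have h3 := h1.comp_hasDerivAt (0 : ℝ) h2
  have : (fun t : ℝ => f (θ + t • v)) = g ∘ fun t : ℝ => restr s θ + t • restr s v := by
    funext t
    exact hfg _
  rw [lineDeriv, this]
  exact h3.deriv

theorem Smooth.act {f : (I → ℝ) → ℝ} (hf : Smooth f) {V : (I → ℝ) → (I → ℝ)}
    (hV : ∀ a, Smooth fun θ => V θ a) : Smooth (act V f) := by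
  obtain ⟨s, g, hg, hfg⟩ := hf
  -- Base point and direction become independent variables, so that a field with smooth components
  -- can be substituted for the direction.
  have h : Smooth fun ζ : s ⊕ s → ℝ => fderiv ℝ g (fun a => ζ (.inl a)) fun a => ζ (.inr a) := by
    apply Smooth.of_contDiff
    have : ContDiff ℝ ∞ (fderiv ℝ g) := hg.fderiv_right (by simp)
    exact (this.comp (by fun_prop)).clm_apply (by fun_prop)
  have h' := h.comp (G := fun θ => Sum.elim (restr s θ) (restr s (V θ)))
    (by rintro (a | a); exacts [Smooth.coord _, hV _])
  convert h' using 1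
  funext θ
  exact lineDeriv_eq_fderiv hg hfg _ _

theorem lineDeriv_coord (a : I) (θ v : I → ℝ) :
    lineDeriv ℝ (fun θ : I → ℝ => θ a) θ v = v a := by
  simp [lineDeriv]

theorem act_coord (V : (I → ℝ) → (I → ℝ)) (a : I) (θ : I → ℝ) :
    act V (fun θ => θ a) θ = V θ a := lineDeriv_coord a θ _

theorem act_const (V : (I → ℝ) → (I → ℝ)) (c : ℝ) (θ : I → ℝ) : act V (fun _ => c) θ = 0 := by
  simp [act, lineDeriv]

theorem act_add (V : (I → ℝ) → (I → ℝ)) {f g : (I → ℝ) → ℝ} (hf : Smooth f) (hg : Smooth g)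
    (θ : I → ℝ) : act V (fun θ => f θ + g θ) θ = act V f θ + act V g θ :=
  ((hf.hasDerivAt θ (V θ)).add (hg.hasDerivAt θ (V θ))).deriv

theorem act_sub (V : (I → ℝ) → (I → ℝ)) {f g : (I → ℝ) → ℝ} (hf : Smooth f) (hg : Smooth g)
    (θ : I → ℝ) : act V (fun θ => f θ - g θ) θ = act V f θ - act V g θ :=
  ((hf.hasDerivAt θ (V θ)).sub (hg.hasDerivAt θ (V θ))).deriv

theorem act_mul (V : (I → ℝ) → (I → ℝ)) {f g : (I → ℝ) → ℝ} (hf : Smooth f) (hg : Smooth g)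
    (θ : I → ℝ) : act V (fun θ => f θ * g θ) θ = act V f θ * g θ + f θ * act V g θ := by
  have h := ((hf.hasDerivAt θ (V θ)).mul (hg.hasDerivAt θ (V θ))).deriv
  simp only [zero_smul, add_zero] at h
  exact h

theorem act_const_mul (V : (I → ℝ) → (I → ℝ)) (c : ℝ) {f : (I → ℝ) → ℝ} (hf : Smooth f)
    (θ : I → ℝ) : act V (fun θ => c * f θ) θ = c * act V f θ := by
  rw [act_mul V (Smooth.const c) hf, act_const]
  ring

/-- The chain rule. -/
theorem act_comp (V : (J → ℝ) → (J → ℝ)) {f : (I → ℝ) → ℝ} (hf : Smooth f)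
    {G : (J → ℝ) → (I → ℝ)} (hG : ∀ a, Smooth fun Θ => G Θ a) (Θ : J → ℝ) :
    act V (fun Θ => f (G Θ)) Θ = lineDeriv ℝ f (G Θ) fun a => act V (fun Θ => G Θ a) Θ := by
  obtain ⟨s, g, hg, hfg⟩ := hf
  rw [lineDeriv_eq_fderiv hg hfg]
  have h1 : HasFDerivAt g (fderiv ℝ g (restr s (G Θ)))
      ((fun t : ℝ => restr s (G (Θ + t • V Θ))) 0) := by
    simpa using ((hg.differentiable (by simp)) (restr s (G Θ))).hasFDerivAt
  have h2 : HasDerivAt (fun t : ℝ => restr s (G (Θ + t • V Θ)))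
      (restr s fun a => act V (fun Θ => G Θ a) Θ) 0 :=
    hasDerivAt_pi.2 fun a => (hG a).hasDerivAt Θ (V Θ)
  have h3 := (h1.comp_hasDerivAt (0 : ℝ) h2).deriv
  rw [← h3]
  simp only [act, lineDeriv, hfg]
  rfl

/-- Fields commute on all smooth functions at a point if they do so on the coordinates. -/
theorem act_comm {V W : (I → ℝ) → (I → ℝ)} (hV : ∀ a, Smooth fun θ => V θ a)
    (hW : ∀ a, Smooth fun θ => W θ a) {θ : I → ℝ}
    (h : ∀ a, act V (fun θ => W θ a) θ = act W (fun θ => V θ a) θ)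
    {f : (I → ℝ) → ℝ} (hf : Smooth f) : act V (act W f) θ = act W (act V f) θ := by
  obtain ⟨s, g, hg, hfg⟩ := hf
  -- V(Wf) = g''(V, W) + g'(V(W)): the first term is symmetric in V and W, and `h` makes the second
  -- one symmetric.
  have key : ∀ {V W : (I → ℝ) → (I → ℝ)}, (∀ a, Smooth fun θ => W θ a) →
      act V (act W f) θ = fderiv ℝ (fderiv ℝ g) (restr s θ) (restr s (V θ)) (restr s (W θ)) +
        fderiv ℝ g (restr s θ) (restr s fun a => act V (fun θ => W θ a) θ) := by
    intro V W hW
    have e : act W f = fun η => fderiv ℝ g (restr s η) (restr s (W η)) :=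
      funext fun η => lineDeriv_eq_fderiv hg hfg _ _
    have hg' : ContDiff ℝ ∞ (fderiv ℝ g) := hg.fderiv_right (by simp)
    have h1 : HasFDerivAt (fderiv ℝ g) (fderiv ℝ (fderiv ℝ g) (restr s θ))
        (restr s θ + (0 : ℝ) • restr s (V θ)) := by
      simpa using ((hg'.differentiable (by simp)) (restr s θ)).hasFDerivAt
    have h2 : HasDerivAt (fun t : ℝ => restr s θ + t • restr s (V θ)) (restr s (V θ)) 0 := by
      simpa using ((hasDerivAt_id (0 : ℝ)).smul_const (restr s (V θ))).const_add (restr s θ)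
    have h3 : HasDerivAt (fun t : ℝ => restr s (W (θ + t • V θ)))
        (restr s fun a => act V (fun θ => W θ a) θ) 0 :=
      hasDerivAt_pi.2 fun a => (hW a).hasDerivAt θ (V θ)
    have h4 : HasDerivAt (fun t : ℝ => fderiv ℝ g (restr s θ + t • restr s (V θ)))
        (fderiv ℝ (fderiv ℝ g) (restr s θ) (restr s (V θ))) 0 := h1.comp_hasDerivAt (0 : ℝ) h2
    have h5 := (h4.clm_apply h3).deriv
    simp only [zero_smul, add_zero] at h5
    rw [← h5, e]
    rfl
  rw [key hW, key hV]
  simp only [h]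
  have hs : IsSymmSndFDerivAt ℝ g (restr s θ) := by
    apply ContDiffAt.isSymmSndFDerivAt (n := ∞) hg.contDiffAt
    simpa using WithTop.coe_le_coe.2 (le_top : (2 : ℕ∞) ≤ ⊤)
  rw [hs.eq]

theorem lineDeriv_congr_of_dependsOn {f : (I → ℝ) → ℝ} {S : Set I} (hf : DependsOn f S)
    (θ : I → ℝ) {v w : I → ℝ} (h : ∀ a ∈ S, v a = w a) : lineDeriv ℝ f θ v = lineDeriv ℝ f θ w := by
  have : (fun t : ℝ => f (θ + t • v)) = fun t : ℝ => f (θ + t • w) :=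
    funext fun t => hf fun a ha => by simp [h a ha]
  rw [lineDeriv, this, lineDeriv]

theorem dependsOn_act {f : (I → ℝ) → ℝ} {V : (I → ℝ) → (I → ℝ)} {S T : Set I}
    (hf : DependsOn f S) (hST : S ⊆ T) (hV : ∀ a ∈ S, DependsOn (fun θ => V θ a) T) :
    DependsOn (act V f) T := by
  intro θ η h
  have : (fun t : ℝ => f (θ + t • V θ)) = fun t : ℝ => f (η + t • V η) :=
    funext fun t => hf fun a ha => by
      have := hV a ha h
      simp only at this
      simp [h a (hST ha), this]
  rw [act, lineDeriv, this, act, lineDeriv]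

/-! ### Triangular systems of equations -/

theorem triangular_unique {rk : I → ℕ} {c : I → ℝ} {k : I → (I → ℝ) → ℝ}
    (hk : ∀ a, DependsOn (k a) {b | rk b < rk a}) {θ φ ψ : I → ℝ}
    (hφ : ∀ a, φ a = c a * θ a + k a φ) (hψ : ∀ a, ψ a = c a * θ a + k a ψ) : φ = ψ := by
  have : ∀ n a, rk a = n → φ a = ψ a := by
    intro n
    induction n using Nat.strong_induction_on with
    | _ n ih =>
      rintro a rfl
      rw [hφ, hψ, hk a fun b hb => ih _ hb b rfl]
  exact funext fun a => this _ a rfl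

theorem exists_triangular_solution {rk : I → ℕ} (c : I → ℝ) {k : I → (I → ℝ) → ℝ}
    (hs : ∀ a, Smooth (k a)) (hk : ∀ a, DependsOn (k a) {b | rk b < rk a}) :
    ∃ Φ : (I → ℝ) → (I → ℝ), (∀ a, Smooth fun θ => Φ θ a) ∧
      ∀ θ a, Φ θ a = c a * θ a + k a (Φ θ) := by
  -- Fixed-point iteration: after n steps all components of rank below n are final. Each component
  -- therefore comes from finitely many substitutions and stays smooth.
  let Ψ : ℕ → (I → ℝ) → (I → ℝ) := fun n =>
    n.rec id fun _ Φ θ a => c a * θ a + k a (Φ θ)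
  have hΨs : ∀ n a, Smooth fun θ => Ψ n θ a := by
    intro n
    induction n with
    | zero => exact Smooth.coord
    | succ n ih => exact fun a => ((Smooth.const _).mul (Smooth.coord a)).add ((hs a).comp ih)
  have hstep : ∀ n θ a, rk a < n → Ψ (n + 1) θ a = Ψ n θ a := by
    intro n
    induction n with
    | zero => intro θ a h; simp at h
    | succ n ih =>
      intro θ a h
      change c a * θ a + k a (Ψ (n + 1) θ) = c a * θ a + k a (Ψ n θ)
      rw [hk a fun b (hb : rk b < rk a) => ih θ b (by omega)]
  have hstab : ∀ n θ a, rk a < n → Ψ n θ a = Ψ (rk a + 1) θ a := by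
    intro n θ a h
    induction n, h using Nat.le_induction with
    | base => rfl
    | succ n h ih => rw [hstep n θ a h, ih]
  refine ⟨fun θ a => Ψ (rk a + 1) θ a, fun a => hΨs (rk a + 1) a, fun θ a => ?_⟩
  change c a * θ a + k a (Ψ (rk a) θ) = _
  rw [hk a fun b hb => hstab _ θ b hb]

end Calculus

/-! ### The internal geometry of the equation -/

section Equation

theorem smooth_totalD (i : Fin 2) (a : Coord) : Smooth fun θ : Jet => totalD i θ a := by
  cases a with
  | x => exact Smooth.const _
  | y => exact Smooth.const _
  | u a b =>
    simp only [totalD]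
    split_ifs
    exacts [Smooth.coord _, Smooth.coord _]

theorem totalD_comm {f : Jet → ℝ} (hf : Smooth f) (i j : Fin 2) (θ : Jet) :
    act (totalD i) (act (totalD j) f) θ = act (totalD j) (act (totalD i) f) θ := by
  refine act_comm (smooth_totalD i) (smooth_totalD j) (fun a => ?_) hf
  cases a with
  | x => simp only [totalD, act_const]
  | y => simp only [totalD, act_const]
  | u a b =>
    fin_cases i <;> fin_cases j <;> simp [totalD, act_coord]

theorem smooth_iterate_act {I : Type} {V : (I → ℝ) → (I → ℝ)} (hV : ∀ a, Smooth fun θ => V θ a)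
    {f : (I → ℝ) → ℝ} (hf : Smooth f) (n : ℕ) : Smooth ((act V)^[n] f) := by
  induction n with
  | zero => exact hf
  | succ n ih =>
    rw [Function.iterate_succ_apply']
    exact ih.act hV

/-- The right-hand side of the equation. -/
def rhs (θ : Jet) : ℝ := (θ (.u 1 0) + θ .x) * θ (.u 1 1) - (θ (.u 2 0) + 2) * θ (.u 0 1)

/-- The derivative `D_x^a D_y^b` of the right-hand side. -/
def rhsDer (a b : ℕ) : Jet → ℝ := (act (totalD 0))^[a] ((act (totalD 1))^[b] rhs)

theorem smooth_rhs : Smooth rhs :=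
  (((Smooth.coord _).add (Smooth.coord _)).mul (Smooth.coord _)).sub
    (((Smooth.coord _).add (Smooth.const 2)).mul (Smooth.coord _))

theorem smooth_rhsDer (a b : ℕ) : Smooth (rhsDer a b) :=
  smooth_iterate_act (smooth_totalD 0) (smooth_iterate_act (smooth_totalD 1) smooth_rhs b) a

theorem act_x_rhsDer (a b : ℕ) : act (totalD 0) (rhsDer a b) = rhsDer (a + 1) b := by
  rw [rhsDer, rhsDer, Function.iterate_succ_apply']

theorem act_y_rhsDer (a b : ℕ) : act (totalD 1) (rhsDer a b) = rhsDer a (b + 1) := by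
  induction a with
  | zero => simp only [rhsDer, Function.iterate_zero, id_eq, Function.iterate_succ_apply']
  | succ a ih =>
    rw [← act_x_rhsDer, ← act_x_rhsDer, ← ih]
    exact funext fun θ => totalD_comm (smooth_rhsDer a b) 1 0 θ

/-- The coordinates with at most `n` derivatives in `y`. -/
def lowOrder (n : ℕ) : Set Coord := {c | ∀ a b, c = .u a b → b ≤ n}

theorem dependsOn_coord {n : ℕ} {c : Coord} (h : c ∈ lowOrder n) :
    DependsOn (fun θ : Jet => θ c) (lowOrder n) := fun _ _ h' => h' c h

/-- The right-hand side has at most one y-derivative, D_y raises this order by at most one and D_x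
does not raise it. This makes the prolonged equation triangular in the y-order. -/
theorem dependsOn_rhsDer (a b : ℕ) : DependsOn (rhsDer a b) (lowOrder (b + 1)) := by
  have hx : ∀ n, .x ∈ lowOrder n := fun n a b h => by simp at h
  have hu : ∀ n a b, b ≤ n → .u a b ∈ lowOrder n := fun n a b h a' b' h' => by
    cases h'
    exact h
  induction a with
  | zero =>
    induction b with
    | zero =>
      intro θ η h
      simp only [rhsDer, Function.iterate_zero, id_eq, rhs]
      rw [h _ (hx _), h _ (hu _ 1 0 (by omega)), h _ (hu _ 1 1 (by omega)),
        h _ (hu _ 2 0 (by omega)), h _ (hu _ 0 1 (by omega))]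
    | succ b ih =>
      rw [← act_y_rhsDer]
      refine dependsOn_act ih (fun c hc a b h => (hc a b h).trans (Nat.le_succ _)) fun c hc => ?_
      cases c with
      | x => exact fun _ _ _ => rfl
      | y => exact fun _ _ _ => rfl
      | u c d => exact dependsOn_coord (hu _ _ _ (Nat.succ_le_succ (hc c d rfl)))
  | succ a ih =>
    rw [← act_x_rhsDer]
    refine dependsOn_act ih subset_rfl fun c hc => ?_
    cases c with
    | x => exact fun _ _ _ => rfl
    | y => exact fun _ _ _ => rfl
    | u c d => exact dependsOn_coord (hu _ _ _ (hc c d rfl))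

theorem mem_rdEq_iff (θ : Jet) : θ ∈ rdEq ↔ ∀ a b, θ (.u a (b + 2)) = rhsDer a b θ := by
  have hy : ∀ b, (act (totalD 1))^[b] (fun θ : Jet => θ (.u 0 2) - rhs θ) =
      fun θ => θ (.u 0 (b + 2)) - rhsDer 0 b θ := by
    intro b
    induction b with
    | zero => rfl
    | succ b ih =>
      rw [Function.iterate_succ_apply', ih]
      funext θ
      rw [act_sub _ (Smooth.coord _) (smooth_rhsDer 0 b), act_y_rhsDer, act_coord]
      simp only [totalD, one_ne_zero, if_false]
  have hx : ∀ a b, (act (totalD 0))^[a] ((act (totalD 1))^[b] fun θ : Jet => θ (.u 0 2) - rhs θ) =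
      fun θ => θ (.u a (b + 2)) - rhsDer a b θ := by
    intro a b
    induction a with
    | zero => exact hy b
    | succ a ih =>
      rw [Function.iterate_succ_apply', ih]
      funext θ
      rw [act_sub _ (Smooth.coord _) (smooth_rhsDer a b), act_x_rhsDer, act_coord]
      simp only [totalD, if_true]
  refine forall_congr' fun a => forall_congr' fun b => ?_
  exact (Eq.congr_left (congrFun (hx a b) θ)).trans sub_eq_zero

theorem smooth_base (a : Coord) : Smooth fun Θ : Total => base Θ a := Smooth.coord _

theorem smooth_liftD {c : NonlocalSystem} (hc : ∀ i n, Smooth (c.coef i n)) (i : Fin 2)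
    (a : Coord ⊕ ℕ) : Smooth fun Θ => c.liftD i Θ a := by
  rcases a with a | n
  · exact (smooth_totalD i a).comp smooth_base
  · exact hc i n

/-- There is a smooth retraction onto the infinitely prolonged equation along which the total
derivatives are tangent to it. -/
theorem exists_retraction {c : NonlocalSystem} :
    ∃ Φ : Total → Total, (∀ a, Smooth fun Θ => Φ Θ a) ∧ (∀ Θ, Φ Θ ∈ overSpace rdEq) ∧
      ∀ Θ ∈ overSpace rdEq, Φ Θ = Θ ∧
        ∀ i a, act (c.liftD i) (fun Θ => Φ Θ a) Θ = c.liftD i Θ a := by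
  let rk : Coord ⊕ ℕ → ℕ := fun
    | .inl (.u _ b) => b
    | _ => 0
  -- The coefficient is 0 on the principal derivatives, which the solution recomputes from the
  -- equation, and 1 on all other coordinates, which it keeps.
  let e : Coord ⊕ ℕ → ℝ := fun
    | .inl (.u _ (_ + 2)) => 0
    | _ => 1
  let k : Coord ⊕ ℕ → Total → ℝ := fun
    | .inl (.u a (b + 2)) => fun Θ => rhsDer a b (base Θ)
    | _ => fun _ => 0
  have hlow : ∀ a b, ∀ s ∈ lowOrder (b + 1), Sum.inl s ∈ {s | rk s < rk (.inl (.u a (b + 2)))} := by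
    intro a b s hs
    cases s with
    | x => exact Nat.succ_pos _
    | y => exact Nat.succ_pos _
    | u s t => exact Nat.lt_succ_of_le (hs s t rfl)
  have hkd : ∀ a b, DependsOn (fun Θ : Total => rhsDer a b (base Θ))
      {s | rk s < rk (.inl (.u a (b + 2)))} := fun a b Θ Θ' h =>
    dependsOn_rhsDer a b fun s hs => h _ (hlow a b s hs)
  have hks : ∀ a, Smooth (k a) := by
    rintro ((_ | _ | ⟨a, _ | _ | b⟩) | n)
    case inl.u.succ.succ => exact (smooth_rhsDer a b).comp smooth_base
    all_goals exact Smooth.const 0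
  have hk : ∀ a, DependsOn (k a) {b | rk b < rk a} := by
    rintro ((_ | _ | ⟨a, _ | _ | b⟩) | n)
    case inl.u.succ.succ => exact hkd a b
    all_goals exact fun _ _ _ => rfl
  obtain ⟨Φ, hΦs, hΦ⟩ := exists_triangular_solution e hks hk
  have hint : ∀ Θ a b, Φ Θ (.inl (.u a (b + 2))) = rhsDer a b (base (Φ Θ)) := fun Θ a b => by
    simpa [e, k] using hΦ Θ (.inl (.u a (b + 2)))
  refine ⟨Φ, hΦs, fun Θ => (mem_rdEq_iff _).2 (hint Θ), fun Θ hΘ => ?_⟩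
  have hfix : Φ Θ = Θ := by
    refine triangular_unique hk (hΦ Θ) ?_
    rintro ((_ | _ | ⟨a, _ | _ | b⟩) | n)
    case inl.u.succ.succ => simpa [e, k, base] using (mem_rdEq_iff _).1 hΘ a b
    all_goals simp [e, k]
  refine ⟨hfix, fun i => ?_⟩
  -- Induction on the y-order. On the equation D_x and D_y send `rhsDer a b` to the values of the
  -- next principal derivatives, which is tangency.
  have key : ∀ n a, rk a = n → act (c.liftD i) (fun Θ => Φ Θ a) Θ = c.liftD i Θ a := by
    intro n
    induction n using Nat.strong_induction_on with
    | _ n ih =>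
      rintro ((_ | _ | ⟨a, _ | _ | b⟩) | n) ha
      case inl.u.succ.succ =>
        have h1 : (fun Θ => Φ Θ (.inl (.u a (b + 2)))) =
            fun Θ => (fun Θ => rhsDer a b (base Θ)) (Φ Θ) := funext fun Θ => hint Θ a b
        rw [h1, act_comp _ ((smooth_rhsDer a b).comp smooth_base) hΦs, hfix,
          lineDeriv_congr_of_dependsOn (hkd a b) (w := c.liftD i Θ) Θ
            (fun s hs => ih _ (ha ▸ hs) s rfl)]
        change act (totalD i) (rhsDer a b) (base Θ) = _
        have hE := (mem_rdEq_iff _).1 hΘ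
        fin_cases i
        · exact (congrFun (act_x_rhsDer a b) _).trans (hE (a + 1) b).symm
        · exact (congrFun (act_y_rhsDer a b) _).trans (hE a (b + 1)).symm
      all_goals
        rw [← act_coord (c.liftD i) _ Θ]
        congr 1
        funext Θ
        simp [hΦ Θ, e, k]
  exact fun a => key _ a rfl

/-- The lifted total derivatives are tangent to the equation. -/
theorem act_eq_of_eqOn {c : NonlocalSystem} (i : Fin 2)
    {f g : Total → ℝ} (hf : Smooth f) (hg : Smooth g) (h : ∀ Θ ∈ overSpace rdEq, f Θ = g Θ)
    {Θ : Total} (hΘ : Θ ∈ overSpace rdEq) : act (c.liftD i) f Θ = act (c.liftD i) g Θ := by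
  -- Composing with the retraction does not change the derivative at `Θ`, and f ∘ Φ = g ∘ Φ
  -- everywhere.
  obtain ⟨Φ, hΦs, hΦ, hfix⟩ := exists_retraction (c := c)
  have key : ∀ {f : Total → ℝ}, Smooth f →
      act (c.liftD i) (fun Θ => f (Φ Θ)) Θ = act (c.liftD i) f Θ := fun {f} hf => by
    rw [act_comp _ hf hΦs, (hfix Θ hΘ).1]
    simp only [(hfix Θ hΘ).2]
    rfl
  rw [← key hf, ← key hg, funext fun Θ => h _ (hΦ Θ)]

end Equation

/-! ### Equivalences defined on the whole of `J^∞ × ℝ^ℕ` -/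

/-- A diffeomorphism of `J^∞ × ℝ^ℕ` over `J^∞` that maps the lifted total derivatives of `c₁` to
those of `c₂`. -/
structure GlobalEquiv (c₁ c₂ : NonlocalSystem) (G : Total ≃ Total) : Prop where
  smooth : ∀ a, Smooth fun Θ => G Θ a
  smooth_symm : ∀ a, Smooth fun Θ => G.symm Θ a
  base_eq : ∀ Θ, base (G Θ) = base Θ
  push : ∀ i Θ a, act (c₁.liftD i) (fun Θ => G Θ a) Θ = c₂.liftD i (G Θ) a

section GlobalEquiv

variable {c₁ c₂ c₃ : NonlocalSystem} {G G' : Total ≃ Total}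

theorem GlobalEquiv.act_comp (h : GlobalEquiv c₁ c₂ G) (i : Fin 2) {f : Total → ℝ}
    (hf : Smooth f) (Θ : Total) :
    act (c₁.liftD i) (fun Θ => f (G Θ)) Θ = act (c₂.liftD i) f (G Θ) := by
  rw [RdDym.act_comp _ hf h.smooth]
  simp only [h.push]
  rfl

theorem GlobalEquiv.symm (h : GlobalEquiv c₁ c₂ G) : GlobalEquiv c₂ c₁ G.symm where
  smooth := h.smooth_symm
  smooth_symm := h.smooth
  base_eq Θ := by simpa using (h.base_eq (G.symm Θ)).symm
  push i Θ a := by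
    have := h.act_comp i (h.smooth_symm a) (G.symm Θ)
    simp only [Equiv.symm_apply_apply, Equiv.apply_symm_apply, act_coord] at this
    exact this.symm

theorem GlobalEquiv.trans (h : GlobalEquiv c₁ c₂ G) (h' : GlobalEquiv c₂ c₃ G') :
    GlobalEquiv c₁ c₃ (G.trans G') where
  smooth a := (h'.smooth a).comp h.smooth
  smooth_symm a := (h.smooth_symm a).comp h'.smooth_symm
  base_eq _ := (h'.base_eq _).trans (h.base_eq _)
  push i _ a := (h.act_comp i (h'.smooth a) _).trans (h'.push i _ a)

theorem SmoothOn.comp {E : Set Jet} {f : overSpace E → ℝ} (hf : SmoothOn (overSpace E) f)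
    {F : overSpace E → overSpace E} {G : Total → Total} (hG : ∀ a, Smooth fun Θ => G Θ a)
    (hFG : ∀ Θ, (F Θ : Total) = G Θ) : SmoothOn (overSpace E) (f ∘ F) := by
  obtain ⟨g, hg, hfg⟩ := hf
  exact ⟨fun Θ => g (G Θ), hg.comp hG, fun Θ => by rw [Function.comp_apply, hfg, hFG]⟩

theorem GlobalEquiv.mem_overSpace (h : GlobalEquiv c₁ c₂ G) (E : Set Jet) (Θ : Total) :
    Θ ∈ overSpace E ↔ G Θ ∈ overSpace E := by
  simp only [overSpace, Set.mem_ofPred_eq, h.base_eq]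

/-- The restriction to the equation is an equivalence of coverings. -/
theorem GlobalEquiv.isEquivalence (h : GlobalEquiv c₁ c₂ G) :
    IsEquivalence rdEq c₁ c₂ (G.subtypeEquiv (h.mem_overSpace rdEq)) where
  smooth f hf := hf.comp h.smooth fun _ => rfl
  smooth_symm f hf := hf.comp h.smooth_symm fun _ => rfl
  base_eq Θ := h.base_eq Θ
  push := by
    refine ⟨fun i j _ => if i = j then 1 else 0, fun i j => ⟨_, Smooth.const _, fun _ => rfl⟩,
      fun i g k hg hk hgk Θ => ?_⟩
    simp only [ite_mul, one_mul, zero_mul, Finset.sum_ite_eq, Finset.mem_univ, if_true]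
    -- `k` and g ∘ G agree only on the equation; tangency makes their derivatives agree there too.
    rw [act_eq_of_eqOn i hk (hg.comp h.smooth) (fun Θ hΘ => hgk ⟨Θ, hΘ⟩) Θ.2, h.act_comp i hg]
    rfl

theorem GlobalEquiv.equivalent (h : GlobalEquiv c₁ c₂ G) : Equivalent rdEq c₁ c₂ :=
  ⟨_, h.isEquivalence⟩

end GlobalEquiv

/-! ### Truncated binomial series -/

section Binomial

open PowerSeries

/-- The generalized binomial coefficient `α (α - 1) ⋯ (α - j + 1) / j!`. -/
def binom (α : ℝ) (j : ℕ) : ℝ := (∏ l ∈ Finset.range j, (α - l)) / (j.factorial : ℝ)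

theorem binom_succ (α : ℝ) (j : ℕ) : ((j : ℝ) + 1) * binom α (j + 1) = (α - j) * binom α j := by
  have : (j.factorial : ℝ) ≠ 0 := by positivity
  have : (j : ℝ) + 1 ≠ 0 := by positivity
  rw [binom, binom, Finset.prod_range_succ, Nat.factorial_succ]
  push_cast
  field_simp

variable {P : Type} [CommRing P] [Algebra ℝ P]

/-- The truncation of `(1 + ρ)^α` after the term of degree `M` in `ρ`. -/
def binomTrunc (α : ℝ) (ρ : P) (M : ℕ) : P :=
  ∑ j ∈ Finset.range (M + 1), algebraMap ℝ P (binom α j) * ρ ^ j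

theorem binomTrunc_succ (α : ℝ) (ρ : P) (M : ℕ) : binomTrunc α ρ (M + 1) =
    binomTrunc α ρ M + algebraMap ℝ P (binom α (M + 1)) * ρ ^ (M + 1) :=
  Finset.sum_range_succ _ _

/-- This is (1 + ρ) Δ((1 + ρ)^α) = α (1 + ρ)^α Δρ for the truncated series: `binom_succ` makes the
sum telescope to a single error term of degree M. -/
theorem one_add_mul_derivation_binomTrunc (α : ℝ) (ρ : P) (Δ : Derivation ℝ P P) (M : ℕ) :
    (1 + ρ) * Δ (binomTrunc α ρ M) = (algebraMap ℝ P α * binomTrunc α ρ M +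
      algebraMap ℝ P ((M - α) * binom α M) * ρ ^ M) * Δ ρ := by
  induction M with
  | zero => simp [binomTrunc]
  | succ M ih =>
    have h := congrArg (algebraMap ℝ P) (binom_succ α M)
    rw [binomTrunc_succ, map_add, mul_add, ih]
    simp only [Derivation.leibniz, Derivation.map_algebraMap, Derivation.leibniz_pow, map_mul,
      map_sub, map_add, map_natCast, map_one, smul_eq_mul, nsmul_eq_mul, Nat.add_sub_cancel,
      Nat.cast_add, Nat.cast_one] at h ⊢
    linear_combination (Δ ρ * ρ ^ M) * h

/-- The system for `1 + ρ` yields the one for its powers, up to the truncation error. -/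
theorem binomTrunc_system (α : ℝ) {ρ X v w : P} {Δx Δy Δ : Derivation ℝ P P} (hu : IsUnit (1 + ρ))
    (hx : Δx ρ = X * (v * Δx ρ - Δy ρ - Δ ρ + (1 + ρ))) (hy : Δy ρ = X * (w * Δx ρ)) (M : ℕ) :
    Δx (binomTrunc α ρ M) = X * (v * Δx (binomTrunc α ρ M) - Δy (binomTrunc α ρ M) -
        Δ (binomTrunc α ρ M) + algebraMap ℝ P α * binomTrunc α ρ M) +
        X * (algebraMap ℝ P ((M - α) * binom α M) * ρ ^ M) ∧
      Δy (binomTrunc α ρ M) = X * (w * Δx (binomTrunc α ρ M)) := by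
  have ex := one_add_mul_derivation_binomTrunc α ρ Δx M
  have ey := one_add_mul_derivation_binomTrunc α ρ Δy M
  have e := one_add_mul_derivation_binomTrunc α ρ Δ M
  set B := binomTrunc α ρ M
  set K := algebraMap ℝ P α * B + algebraMap ℝ P ((M - α) * binom α M) * ρ ^ M with hK
  -- After multiplication by the unit 1 + ρ, every derivative of B is K times the same derivative of
  -- ρ, so the claim is K times the system for ρ.
  refine ⟨hu.mul_left_cancel ?_, hu.mul_left_cancel ?_⟩
  · linear_combination ex - X * v * ex + X * ey + X * e + K * hx + (1 + ρ) * X * hK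
  · linear_combination ey - X * w * ex + K * hy

end Binomial

/-! ### Derivations of power series and the system for powers of a generating series -/

section PowerSeriesDerivation

open PowerSeries

variable {A : Type} [CommRing A] [Algebra ℝ A]

/-- The coefficientwise extension of a derivation to power series. -/
def coeffDer (δ : Derivation ℝ A A) : Derivation ℝ A⟦X⟧ A⟦X⟧ :=
  Derivation.mk'
    { toFun := fun f => PowerSeries.mk fun n => δ (coeff n f)
      map_add' := fun f g => by ext n; simp
      map_smul' := fun c f => by ext n; simp }
    fun f g => by
      ext n
      simp only [LinearMap.coe_mk, AddHom.coe_mk, coeff_mk, coeff_mul, map_sum, Derivation.leibniz,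
        smul_eq_mul, map_add, Finset.sum_add_distrib]
      congr 1
      exact Finset.Nat.sum_antidiagonal_swap.symm

theorem coeff_coeffDer (δ : Derivation ℝ A A) (n : ℕ) (f : A⟦X⟧) :
    coeff n (coeffDer δ f) = δ (coeff n f) := by
  simp [coeffDer]

/-- The Euler derivation `X d/dX` of power series. -/
def eulerDer (A : Type) [CommRing A] [Algebra ℝ A] : Derivation ℝ A⟦X⟧ A⟦X⟧ :=
  (X : A⟦X⟧) • (PowerSeries.derivative A).restrictScalars ℝ

theorem coeff_eulerDer (n : ℕ) (f : A⟦X⟧) : coeff n (eulerDer A f) = n * coeff n f := by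
  cases n with
  | zero => simp [eulerDer]
  | succ n => simp [eulerDer, coeff_succ_X_mul, coeff_derivative, mul_comm]

theorem coeff_X_mul_pow {A : Type} [CommRing A] (f : A⟦X⟧) (m j : ℕ) :
    coeff m ((X * f) ^ j) = if j ≤ m then coeff (m - j) (f ^ j) else 0 := by
  rw [mul_pow, coeff_X_pow_mul']

/-- The `m`-th coefficient of `(1 + X f)^α`. -/
def powCoeff (α : ℝ) (f : A⟦X⟧) (m : ℕ) : A := coeff m (binomTrunc α (X * f) m)

theorem coeff_binomTrunc (α : ℝ) (f : A⟦X⟧) {m M : ℕ} (h : m ≤ M) :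
    coeff m (binomTrunc α (X * f) M) = powCoeff α f m := by
  induction M, h using Nat.le_induction with
  | base => rfl
  | succ M h ih =>
    rw [binomTrunc_succ, map_add, ih, ← Algebra.smul_def, coeff_smul, coeff_X_mul_pow,
      if_neg (by omega), smul_zero, add_zero]

/-- The term j = 0 does not reach positive degree and j = 1 is linear in f; the others, with j = k +
2, have the shape of the sum d_i. -/
theorem powCoeff_succ (α : ℝ) (f : A⟦X⟧) (m : ℕ) : powCoeff α f (m + 1) =
    α • coeff m f + ∑ k ∈ Finset.range m, binom α (k + 2) • coeff (m - 1 - k) (f ^ (k + 2)) := by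
  rw [powCoeff, binomTrunc, map_sum, Finset.sum_range_succ', Finset.sum_range_succ']
  simp only [← Algebra.smul_def, coeff_smul, coeff_X_mul_pow]
  rw [add_assoc, add_comm]
  congr 1
  · simp [binom, coeff_one]
  · refine Finset.sum_congr rfl fun k hk => ?_
    rw [Finset.mem_range] at hk
    rw [if_pos (by omega), show m + 1 - (k + 1 + 1) = m - 1 - k by omega]

/-- If `1 + ∑ r_{k+1} X^{k+1}` obeys the recursion with `p = -3`, then its `α`-th power does with
`p = -α - 2`. -/
theorem powCoeff_system (α : ℝ) (f : A⟦X⟧) (v w : A) (δx δy : Derivation ℝ A A)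
    (h0x : δx (coeff 0 f) = 1) (h0y : δy (coeff 0 f) = 0)
    (hx : ∀ k : ℕ, δx (coeff (k + 1) f) =
      v * δx (coeff k f) - δy (coeff k f) - (k : A) * coeff k f)
    (hy : ∀ k : ℕ, δy (coeff (k + 1) f) = w * δx (coeff k f)) (k : ℕ) :
    δx (powCoeff α f (k + 1)) = v * δx (powCoeff α f k) - δy (powCoeff α f k)
        + algebraMap ℝ A (α - k) * powCoeff α f k ∧
      δy (powCoeff α f (k + 1)) = w * δx (powCoeff α f k) := by
  have hu : IsUnit (1 + X * f) := by
    rw [PowerSeries.isUnit_iff_constantCoeff]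
    simp
  have h := binomTrunc_system α (ρ := X * f) (X := X) (v := C v) (w := C w) (Δx := coeffDer δx)
    (Δy := coeffDer δy) (Δ := eulerDer A) hu
    (by
      ext n
      rcases n with _ | _ | n
      · simp [coeff_coeffDer, -Derivation.leibniz]
      · simp only [coeff_coeffDer, coeff_succ_X_mul, map_add, map_sub, coeff_C_mul,
          coeff_eulerDer, h0x]
        simp
      -- The Euler term contributes -(n + 1) and the summand 1 + ρ contributes +1, which leaves the
      -- factor -n of `hx`.
      · simp only [coeff_coeffDer, coeff_succ_X_mul, map_add, map_sub, coeff_C_mul,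
          coeff_eulerDer, hx, coeff_one]
        simp
        ring)
    (by
      ext n
      rcases n with _ | _ | n
      · simp [coeff_coeffDer, -Derivation.leibniz]
      · simp [-Derivation.leibniz, coeff_coeffDer, coeff_succ_X_mul] at h0y ⊢
        exact h0y
      · simp only [coeff_coeffDer, coeff_succ_X_mul, coeff_C_mul, hy]) (k + 1)
  obtain ⟨h1, h2⟩ := h
  -- With truncation at degree k + 1 the error X ρ^(k+1) has order at least k + 2, so it is
  -- invisible in this coefficient.
  have h1 := congrArg (coeff (k + 1)) h1
  have h2 := congrArg (coeff (k + 1)) h2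
  simp only [map_add, map_sub, coeff_coeffDer, coeff_succ_X_mul, coeff_C_mul, coeff_eulerDer,
    ← Algebra.smul_def, coeff_smul, coeff_X_mul_pow, coeff_binomTrunc α f le_rfl,
    coeff_binomTrunc α f (Nat.le_succ k), if_neg (Nat.not_succ_le_self k), smul_zero, add_zero]
    at h1 h2
  refine ⟨?_, h2⟩
  rw [h1, map_sub, map_natCast, Algebra.smul_def]
  ring

end PowerSeriesDerivation

/-! ### The polynomials `Q_{i,j}` as coefficients of powers of a generating series -/

section QPolynomials

open PowerSeries

/-- Z sends the n-th variable to n + 1 times the next one, so on the generic series it acts as d/dX;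
being derivations, the two also agree on powers. -/
theorem Z_coeff_pow (N j : ℕ) :
    Z (coeff j ((PowerSeries.mk MvPolynomial.X : (MvPolynomial ℕ ℝ)⟦X⟧) ^ N)) =
      coeff (j + 1) ((PowerSeries.mk MvPolynomial.X : (MvPolynomial ℕ ℝ)⟦X⟧) ^ N) *
        MvPolynomial.C ((j : ℝ) + 1) := by
  set f : (MvPolynomial ℕ ℝ)⟦X⟧ := PowerSeries.mk MvPolynomial.X
  have h : coeffDer Z (f ^ N) = PowerSeries.derivative _ (f ^ N) := by
    have h1 : coeffDer Z f = PowerSeries.derivative _ f := by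
      ext1 n
      rw [coeff_coeffDer, coeff_derivative]
      simp [f, Z, MvPolynomial.mkDerivation_X, mul_comm]
    rw [Derivation.leibniz_pow, Derivation.leibniz_pow, h1]
  have := congrArg (coeff j) h
  rw [coeff_coeffDer, coeff_derivative] at this
  rw [this]
  simp

theorem Q_eq_coeff (i j : ℕ) : Q i j = MvPolynomial.C (1 / ((i + 2).factorial : ℝ)) *
    coeff j ((PowerSeries.mk MvPolynomial.X : (MvPolynomial ℕ ℝ)⟦X⟧) ^ (i + 2)) := by
  induction j with
  | zero => simp [Q]
  | succ j ih =>
    have : (j : ℝ) + 1 ≠ 0 := by positivity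
    rw [Q, ih, ← MvPolynomial.smul_eq_C_mul _ (1 / ((i + 2).factorial : ℝ)), Derivation.map_smul,
      Z_coeff_pow, MvPolynomial.smul_eq_C_mul]
    have h : MvPolynomial.C (1 / ((j : ℝ) + 1)) * MvPolynomial.C ((j : ℝ) + 1) =
        (1 : MvPolynomial ℕ ℝ) := by
      rw [← MvPolynomial.C_mul, one_div_mul_cancel this, MvPolynomial.C_1]
    linear_combination (MvPolynomial.C (1 / ((i + 2).factorial : ℝ)) * coeff (j + 1)
      ((PowerSeries.mk MvPolynomial.X : (MvPolynomial ℕ ℝ)⟦X⟧) ^ (i + 2))) * h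

theorem eval_Q (a : ℕ → ℝ) (i j : ℕ) : MvPolynomial.eval a (Q i j) =
    1 / ((i + 2).factorial : ℝ) * coeff j (PowerSeries.mk a ^ (i + 2)) := by
  rw [Q_eq_coeff, map_mul, MvPolynomial.eval_C, ← PowerSeries.coeff_map, map_pow]
  congr 3
  ext n
  simp

/-- This locality is what makes the transformation triangular. -/
theorem coeff_mk_pow_congr {a b : ℕ → ℝ} (N : ℕ) {j : ℕ} (h : ∀ i ≤ j, a i = b i) :
    coeff j (PowerSeries.mk a ^ N) = coeff j (PowerSeries.mk b ^ N) := by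
  induction N generalizing j with
  | zero => simp
  | succ N ih =>
    rw [pow_succ, pow_succ, coeff_mul, coeff_mul]
    refine Finset.sum_congr rfl fun x hx => ?_
    rw [Finset.HasAntidiagonal.mem_antidiagonal] at hx
    rw [ih fun i hi => h i (by omega), coeff_mk, coeff_mk, h _ (by omega)]

end QPolynomials

/-! ### The coverings `ρ^p` -/

section Coverings

/-- The normalization r^{-2}_{-1} = 1 plays the role of r^{-1}_{-2} = 1, and the coefficient p + i +
3 is unchanged when p drops by one and i grows by one. -/
theorem r_neg_two_succ (k : ℕ) : r (-2) (k + 1) = r (-1) k := by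
  funext Θ
  rcases k with _ | _ | _ | k
  · simp [r]
  · norm_num [r]
  · norm_num [r]
  · simp [r]

theorem rDer_neg_two_succ (k : ℕ) : rDer (-2) (k + 1) = rDer (-1) k := by
  induction k with
  | zero => funext Θ; simp [rDer]
  | succ k ih =>
    funext Θ
    rw [rDer, ih, r_neg_two_succ, rDer]
    push_cast
    congr 2
    ring

theorem rho_neg_two : rho (-2) = rho (-1) := by
  rw [rho, rho, show firstNonlocal (-2) = 4 from rfl, show firstNonlocal (-1) = 3 from rfl]
  congr 1
  funext i n Θ
  rw [← rDer_neg_two_succ]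

theorem r_zero (p : ℤ) : r p 0 = fun _ => 1 := by
  funext Θ
  simp [r]

theorem r_one {p : ℤ} (hp : p ≠ -2) : r p 1 = fun Θ => -((p : ℝ) + 2) * Θ (.inl .x) := by
  funext Θ
  simp [r, hp]

theorem r_two {p : ℤ} (hp : p ≠ -2) : r p 2 = fun Θ => -((p : ℝ) + 2) * Θ (.inl (.u 0 0)) +
    (((p : ℝ) + 2) ^ 2 / 2) * (Θ (.inl .x) * Θ (.inl .x)) := by
  funext Θ
  simp only [r, if_neg hp]
  ring

theorem r_add_three {p : ℤ} (hp : p ≠ -2) (n : ℕ) : r p (n + 3) = fun Θ => Θ (.inr n) := by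
  funext Θ
  simp [r, hp]

theorem smooth_r_of_ne {p : ℤ} (hp : p ≠ -2) (k : ℕ) : Smooth (r p k) := by
  rcases k with _ | _ | _ | k
  · rw [r_zero]
    exact Smooth.const 1
  · rw [r_one hp]
    exact (Smooth.const _).mul (Smooth.coord _)
  · rw [r_two hp]
    exact ((Smooth.const _).mul (Smooth.coord _)).add
      ((Smooth.const _).mul ((Smooth.coord _).mul (Smooth.coord _)))
  · rw [r_add_three hp]
    exact Smooth.coord _

theorem smooth_r (p : ℤ) (k : ℕ) : Smooth (r p k) := by
  by_cases hp : p = -2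
  · subst hp
    cases k with
    | zero =>
      rw [r_zero]
      exact Smooth.const 1
    | succ k =>
      rw [r_neg_two_succ]
      exact smooth_r_of_ne (by decide) k
  · exact smooth_r_of_ne hp k

theorem smooth_rDer (p : ℤ) (k : ℕ) :
    Smooth (fun Θ => (rDer p k Θ).1) ∧ Smooth (fun Θ => (rDer p k Θ).2) := by
  induction k with
  | zero => exact ⟨Smooth.const 0, Smooth.const 0⟩
  | succ k ih =>
    exact ⟨((((Smooth.coord _).add (Smooth.coord _)).mul ih.1).sub ih.2).sub
      ((Smooth.const _).mul (smooth_r p k)), (Smooth.coord _).mul ih.1⟩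

theorem smooth_coef (p : ℤ) (i : Fin 2) (n : ℕ) : Smooth ((rho p).coef i n) := by
  fin_cases i
  · exact (smooth_rDer p _).1
  · exact (smooth_rDer p _).2

theorem act_r_of_ne {p : ℤ} (hp : p ≠ -2) (k : ℕ) (Θ : Total) :
    act ((rho p).liftD 0) (r p k) Θ = (rDer p k Θ).1 ∧
      act ((rho p).liftD 1) (r p k) Θ = (rDer p k Θ).2 := by
  have hx : Smooth fun Θ : Total => Θ (.inl .x) := Smooth.coord _
  have hu : Smooth fun Θ : Total => Θ (.inl (.u 0 0)) := Smooth.coord _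
  rcases k with _ | _ | _ | k
  · rw [r_zero, act_const, act_const]
    exact ⟨rfl, rfl⟩
  · rw [r_one hp, act_const_mul _ _ hx, act_const_mul _ _ hx, act_coord, act_coord]
    constructor <;> simp [NonlocalSystem.liftD, totalD, rDer, r_zero]
  · have h1 := (Smooth.const (I := Coord ⊕ ℕ) (-((p : ℝ) + 2))).mul hu
    have h2 := (Smooth.const (I := Coord ⊕ ℕ) (((p : ℝ) + 2) ^ 2 / 2)).mul (hx.mul hx)
    simp only [r_two hp, act_add _ h1 h2, act_const_mul _ _ hu, act_const_mul _ _ (hx.mul hx),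
      act_mul _ hx hx, act_coord]
    constructor
    · simp [NonlocalSystem.liftD, totalD, rDer, r_zero, r_one hp, base]
      ring
    · simp [NonlocalSystem.liftD, totalD, rDer, r_zero, base]
      ring
  · rw [r_add_three hp, act_coord, act_coord]
    simp [NonlocalSystem.liftD, rho, firstNonlocal, hp]

/-- The functions `r^p_i` satisfy the defining equations. -/
theorem act_r (p : ℤ) (k : ℕ) (Θ : Total) :
    act ((rho p).liftD 0) (r p k) Θ = (rDer p k Θ).1 ∧
      act ((rho p).liftD 1) (r p k) Θ = (rDer p k Θ).2 := by
  by_cases hp : p = -2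
  · subst hp
    cases k with
    | zero =>
      rw [r_zero, act_const, act_const]
      exact ⟨rfl, rfl⟩
    | succ k =>
      rw [r_neg_two_succ, rDer_neg_two_succ, rho_neg_two]
      exact act_r_of_ne (by decide) k Θ
  · exact act_r_of_ne hp k Θ

theorem act_rDer_succ (V : Total → Total) (p : ℤ) (k : ℕ) (Θ : Total) :
    act V (fun Θ => (rDer p (k + 1) Θ).1) Θ =
        (V Θ (.inl (.u 1 0)) + V Θ (.inl .x)) * (rDer p k Θ).1 +
          (Θ (.inl (.u 1 0)) + Θ (.inl .x)) * act V (fun Θ => (rDer p k Θ).1) Θ -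
          act V (fun Θ => (rDer p k Θ).2) Θ - (p + k + 2) * act V (r p k) Θ ∧
      act V (fun Θ => (rDer p (k + 1) Θ).2) Θ =
        V Θ (.inl (.u 0 1)) * (rDer p k Θ).1 +
          Θ (.inl (.u 0 1)) * act V (fun Θ => (rDer p k Θ).1) Θ := by
  obtain ⟨h1, h2⟩ := smooth_rDer p k
  have hx : Smooth fun Θ : Total => Θ (.inl .x) := Smooth.coord _
  have hu : Smooth fun Θ : Total => Θ (.inl (.u 1 0)) := Smooth.coord _
  have hr : Smooth fun Θ => ((p : ℝ) + k + 2) * r p k Θ := (Smooth.const _).mul (smooth_r p k)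
  constructor
  · simp only [rDer]
    rw [act_sub _ (((hu.add hx).mul h1).sub h2) hr, act_sub _ ((hu.add hx).mul h1) h2,
      act_mul _ (hu.add hx) h1, act_add _ hu hx, act_coord, act_coord,
      act_const_mul _ _ (smooth_r p k)]
  · simp only [rDer]
    rw [act_mul _ (Smooth.coord _) h1, act_coord]

theorem rDer_compatible (p : ℤ) {Θ : Total} (hΘ : Θ ∈ overSpace rdEq) (k : ℕ) :
    act ((rho p).liftD 0) (fun Θ => (rDer p k Θ).2) Θ =
      act ((rho p).liftD 1) (fun Θ => (rDer p k Θ).1) Θ := by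
  have hE : Θ (.inl (.u 0 2)) = (Θ (.inl (.u 1 0)) + Θ (.inl .x)) * Θ (.inl (.u 1 1)) -
      (Θ (.inl (.u 2 0)) + 2) * Θ (.inl (.u 0 1)) := (mem_rdEq_iff _).1 hΘ 0 0
  induction k using Nat.twoStepInduction with
  | zero => simp only [rDer, act_const]
  | one =>
    have e1 : (fun Θ => (rDer p 1 Θ).1) = fun _ => -((p : ℝ) + 2) := by
      funext Θ
      simp [rDer, r_zero]
    have e2 : (fun Θ => (rDer p 1 Θ).2) = fun _ => 0 := by
      funext Θ
      simp [rDer]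
    rw [e1, e2, act_const, act_const]
  -- Unfolding two levels and using both induction hypotheses leaves r_{i,x}, two indices lower,
  -- times the equation. No differential consequence of the equation is needed.
  | more k ih0 ih1 =>
    rw [(act_rDer_succ _ p (k + 1) Θ).1, (act_rDer_succ _ p (k + 1) Θ).2,
      (act_r p (k + 1) Θ).2, ← ih1, (act_rDer_succ _ p k Θ).2, (act_rDer_succ _ p k Θ).2,
      (act_rDer_succ _ p k Θ).1, (act_r p k Θ).1, ih0]
    simp only [NonlocalSystem.liftD, totalD, Sum.elim_inl, base, if_true, one_ne_zero,
      if_false]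
    rw [rDer]
    simp only
    push_cast
    linear_combination (rDer p k Θ).1 * hE

theorem isCovering_rho (p : ℤ) : (rho p).IsCovering rdEq := by
  refine ⟨smooth_coef p, fun f hf Θ hΘ =>
    act_comm (smooth_liftD (smooth_coef p) 0) (smooth_liftD (smooth_coef p) 1) ?_ hf⟩
  rintro ((_ | _ | ⟨a, b⟩) | n)
  · exact (act_const _ _ _).trans (act_const _ _ _).symm
  · exact (act_const _ _ _).trans (act_const _ _ _).symm
  · simp [NonlocalSystem.liftD, totalD, base, act_coord]
  · exact rDer_compatible p hΘ _

end Coverings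

/-! ### The transformation from `ρ^{-3}` to `ρ^p` -/

section Transformation

open PowerSeries

/-- The algebra of smooth functions. -/
def smoothAlg (I : Type) : Subalgebra ℝ ((I → ℝ) → ℝ) where
  carrier := {f | Smooth f}
  mul_mem' hf hg := hf.mul hg
  add_mem' hf hg := hf.add hg
  algebraMap_mem' c := Smooth.const c

/-- A smooth field as a derivation. -/
def actDer {I : Type} (V : (I → ℝ) → (I → ℝ)) (hV : ∀ a, Smooth fun θ => V θ a) :
    Derivation ℝ (smoothAlg I) (smoothAlg I) :=
  Derivation.mk'
    { toFun := fun f => ⟨act V f.1, f.2.act hV⟩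
      map_add' := fun f g => Subtype.ext (funext fun θ => act_add V f.2 g.2 θ)
      map_smul' := fun c f => Subtype.ext (funext fun θ => act_const_mul V c f.2 θ) }
    fun f g => Subtype.ext (funext fun θ => (act_mul V f.2 g.2 θ).trans (by
      change _ = f.1 θ * act V g.1 θ + g.1 θ * act V f.1 θ
      ring))

/-- The series `∑ r^{-3}_{i-1} X^i`, `i ≥ 0`. -/
def rSeries : (smoothAlg (Coord ⊕ ℕ))⟦X⟧ := PowerSeries.mk fun a => ⟨r (-3) (a + 1), smooth_r _ _⟩

/-- The coefficients of the power `-(p+2)` of the generating function of the `r^{-3}_i`. -/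
def rPow (p : ℤ) (k : ℕ) : Total → ℝ := (powCoeff (-((p : ℝ) + 2)) rSeries k).1

theorem smooth_rPow (p : ℤ) (k : ℕ) : Smooth (rPow p k) :=
  (powCoeff (-((p : ℝ) + 2)) rSeries k).2

/-- The first two factors of the falling factorial give (p+2)(p+3), the prefactor of d_i in the
transformation; the others give the signed product inside d_i. -/
theorem binom_neg_add_two (p : ℝ) (k : ℕ) : binom (-(p + 2)) (k + 2) =
    (p + 2) * (p + 3) * ((-1) ^ k * ∏ l ∈ Finset.range k, (p + 4 + l)) *
      (1 / ((k + 2).factorial : ℝ)) := by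
  have h : ∏ l ∈ Finset.range k, (-(p + 2) - ((l + 1 + 1 : ℕ) : ℝ)) =
      (-1) ^ k * ∏ l ∈ Finset.range k, (p + 4 + l) := by
    induction k with
    | zero => simp
    | succ k ih =>
      rw [Finset.prod_range_succ, Finset.prod_range_succ, ih]
      push_cast
      ring
  rw [binom, Finset.prod_range_succ', Finset.prod_range_succ', h]
  push_cast
  ring

theorem coeff_rSeries_pow (N j : ℕ) (Θ : Total) : (coeff j (rSeries ^ N)).1 Θ =
    coeff j (PowerSeries.mk (fun a => r (-3) (a + 1) Θ) ^ N) := by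
  let ev : smoothAlg (Coord ⊕ ℕ) →+* ℝ :=
    (Pi.evalRingHom (fun _ : Total => ℝ) Θ).comp (smoothAlg (Coord ⊕ ℕ)).val.toRingHom
  change ev _ = _
  rw [← PowerSeries.coeff_map, map_pow]
  congr 2

theorem rPow_succ (p : ℤ) (m : ℕ) (Θ : Total) : rPow p (m + 1) Θ =
    -((p : ℝ) + 2) * (r (-3) (m + 1) Θ - ((p : ℝ) + 3) * d p m Θ) := by
  have h : rPow p (m + 1) Θ = -((p : ℝ) + 2) * r (-3) (m + 1) Θ + ∑ k ∈ Finset.range m,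
      binom (-((p : ℝ) + 2)) (k + 2) * (coeff (m - 1 - k) (rSeries ^ (k + 2))).1 Θ := by
    rw [rPow, powCoeff_succ]
    simp [rSeries]
  rw [h, d, mul_sub, sub_eq_add_neg, Finset.mul_sum, Finset.mul_sum, ← Finset.sum_neg_distrib]
  congr 1
  refine Finset.sum_congr rfl fun k _ => ?_
  rw [coeff_rSeries_pow, eval_Q, binom_neg_add_two]
  ring

theorem rPow_zero (p : ℤ) : rPow p 0 = fun _ => 1 := by
  funext Θ
  simp [rPow, powCoeff, binomTrunc, binom]

theorem smooth_d (p : ℤ) (m : ℕ) : Smooth (d p m) := by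
  have h : d p m = fun Θ => ∑ k ∈ Finset.range m, (-1) ^ k *
      (∏ l ∈ Finset.range k, ((p : ℝ) + 4 + l)) *
        (1 / ((k + 2).factorial : ℝ) * (coeff (m - 1 - k) (rSeries ^ (k + 2))).1 Θ) := by
    funext Θ
    simp only [d, eval_Q, coeff_rSeries_pow]
  rw [h]
  exact Smooth.sum _ fun k _ => (Smooth.const _).mul ((Smooth.const _).mul (Subtype.prop _))

/-- Here `d p m` is d_{m-1}, and the variables that occur are r_{-1}, …, r_{m-2}, all of index below
m - 1. -/
theorem d_congr (p : ℤ) {m : ℕ} {Θ Θ' : Total}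
    (h : ∀ i < m, r (-3) (i + 1) Θ = r (-3) (i + 1) Θ') : d p m Θ = d p m Θ' := by
  refine Finset.sum_congr rfl fun k hk => ?_
  rw [Finset.mem_range] at hk
  rw [eval_Q, eval_Q, coeff_mk_pow_congr _ fun i hi => h i (by omega)]

theorem act_rPow_succ (p : ℤ) (k : ℕ) (Θ : Total) :
    act ((rho (-3)).liftD 0) (rPow p (k + 1)) Θ =
        (Θ (.inl (.u 1 0)) + Θ (.inl .x)) * act ((rho (-3)).liftD 0) (rPow p k) Θ -
          act ((rho (-3)).liftD 1) (rPow p k) Θ - (p + k + 2) * rPow p k Θ ∧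
      act ((rho (-3)).liftD 1) (rPow p (k + 1)) Θ =
        Θ (.inl (.u 0 1)) * act ((rho (-3)).liftD 0) (rPow p k) Θ := by
  have hV := fun i => smooth_liftD (smooth_coef (-3)) i
  have h := powCoeff_system (-((p : ℝ) + 2)) rSeries
    ⟨fun Θ => Θ (.inl (.u 1 0)) + Θ (.inl .x), (Smooth.coord _).add (Smooth.coord _)⟩
    ⟨fun Θ => Θ (.inl (.u 0 1)), Smooth.coord _⟩ (actDer _ (hV 0)) (actDer _ (hV 1))
    (by
      rw [rSeries, coeff_mk]
      refine Subtype.ext (funext fun Θ => ?_)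
      change act ((rho (-3)).liftD 0) (r (-3) 1) Θ = 1
      rw [(act_r (-3) 1 Θ).1]
      norm_num [rDer, r_zero])
    (by
      rw [rSeries, coeff_mk]
      refine Subtype.ext (funext fun Θ => ?_)
      change act ((rho (-3)).liftD 1) (r (-3) 1) Θ = 0
      rw [(act_r (-3) 1 Θ).2]
      simp [rDer])
    (fun k => by
      rw [rSeries, coeff_mk, coeff_mk]
      refine Subtype.ext (funext fun Θ => (act_r (-3) (k + 2) Θ).1.trans ?_)
      -- At p = -3 the factor p + (k + 1) + 2 is k.
      rw [rDer, ← (act_r (-3) (k + 1) Θ).1, ← (act_r (-3) (k + 1) Θ).2]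
      change _ = (Θ (.inl (.u 1 0)) + Θ (.inl .x)) * act ((rho (-3)).liftD 0) (r (-3) (k + 1)) Θ -
        act ((rho (-3)).liftD 1) (r (-3) (k + 1)) Θ - (k : ℝ) * r (-3) (k + 1) Θ
      push_cast
      ring)
    (fun k => by
      rw [rSeries, coeff_mk, coeff_mk]
      refine Subtype.ext (funext fun Θ => (act_r (-3) (k + 2) Θ).2.trans ?_)
      rw [rDer, ← (act_r (-3) (k + 1) Θ).1]
      rfl) k
  have h1 := congrFun (congrArg Subtype.val h.1) Θ
  have h2 := congrFun (congrArg Subtype.val h.2) Θ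
  refine ⟨h1.trans ?_, h2⟩
  change (Θ (.inl (.u 1 0)) + Θ (.inl .x)) * act ((rho (-3)).liftD 0) (rPow p k) Θ -
    act ((rho (-3)).liftD 1) (rPow p k) Θ + (-((p : ℝ) + 2) - k) * rPow p k Θ = _
  ring

/-- The transformation with components `r^p_i = rPow p`. -/
def transform (p : ℤ) (Θ : Total) : Total := Sum.elim (base Θ) fun n => rPow p (n + 3) Θ

theorem smooth_transform (p : ℤ) (a : Coord ⊕ ℕ) : Smooth fun Θ => transform p Θ a := by
  rcases a with a | n
  exacts [Smooth.coord _, smooth_rPow p _]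

/-- The transformation sets only the fibre coordinates, so the prescribed local functions r_{-1},
r_0 must match the first coefficients of the power. For r_0 this is -(p+2)(1 - (p+3)) = (p+2)^2 in
front of x²/2. -/
theorem r_transform {p : ℤ} (hp : p ≠ -2) (k : ℕ) (Θ : Total) :
    r p k (transform p Θ) = rPow p k Θ := by
  rcases k with _ | _ | _ | k
  · rw [r_zero, rPow_zero]
  · rw [r_one hp, rPow_succ, r_one (by decide)]
    have h : d p 0 Θ = 0 := Finset.sum_range_zero _
    simp only [h, transform, Sum.elim_inl, base]
    push_cast
    ring
  · rw [r_two hp, rPow_succ, r_two (by decide)]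
    simp [d, transform, base, Q, r_one]
    ring
  · rw [r_add_three hp]
    rfl

theorem act_rPow {p : ℤ} (hp : p ≠ -2) (k : ℕ) (Θ : Total) :
    act ((rho (-3)).liftD 0) (rPow p k) Θ = (rDer p k (transform p Θ)).1 ∧
      act ((rho (-3)).liftD 1) (rPow p k) Θ = (rDer p k (transform p Θ)).2 := by
  induction k with
  | zero =>
    rw [rPow_zero, act_const, act_const]
    exact ⟨rfl, rfl⟩
  | succ k ih =>
    rw [(act_rPow_succ p k Θ).1, (act_rPow_succ p k Θ).2, ih.1, ih.2, ← r_transform hp]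
    exact ⟨rfl, rfl⟩

theorem exists_globalEquiv {p : ℤ} (hp : p ≠ -2) : ∃ G : Total ≃ Total,
    GlobalEquiv (rho (-3)) (rho p) G ∧ ∀ Θ, G Θ = transform p Θ := by
  have hp' : -((p : ℝ) + 2) ≠ 0 := by
    rw [neg_ne_zero]
    exact_mod_cast fun h : p + 2 = 0 => hp (by omega)
  let rk : Coord ⊕ ℕ → ℕ := Sum.elim (fun _ => 0) (· + 1)
  -- The inverse solves r^{-3}_i = -r^p_i/(p+2) + (p+3) d_i recursively. The fibre coordinate n is
  -- r_{n+1}, whence `d p (n + 2)`.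
  let e : Coord ⊕ ℕ → ℝ := Sum.elim (fun _ => 1) fun _ => (-((p : ℝ) + 2))⁻¹
  let k : Coord ⊕ ℕ → Total → ℝ := Sum.elim (fun _ _ => 0) fun n Θ => ((p : ℝ) + 3) * d p (n + 2) Θ
  have hks : ∀ a, Smooth (k a) := by
    rintro (a | n)
    exacts [Smooth.const 0, (Smooth.const _).mul (smooth_d p _)]
  have hk : ∀ a, DependsOn (k a) {b | rk b < rk a} := by
    rintro (a | n) Θ Θ' h
    · rfl
    · refine congrArg (((p : ℝ) + 3) * ·) (d_congr p fun i hi => ?_)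
      rcases i with _ | _ | i
      · simp only [r_one (show (-3 : ℤ) ≠ -2 by decide)]
        rw [h (.inl .x) (Nat.succ_pos n)]
      · simp only [r_two (show (-3 : ℤ) ≠ -2 by decide)]
        rw [h (.inl .x) (Nat.succ_pos n), h (.inl (.u 0 0)) (Nat.succ_pos n)]
      · simp only [r_add_three (show (-3 : ℤ) ≠ -2 by decide)]
        exact h (.inr i) (show i + 1 < n + 1 by omega)
  obtain ⟨Φ, hΦs, hΦ⟩ := exists_triangular_solution e hks hk
  have hinr : ∀ Θ n, transform p Θ (.inr n) =
      -((p : ℝ) + 2) * (Θ (.inr n) - ((p : ℝ) + 3) * d p (n + 2) Θ) := fun Θ n => by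
    rw [transform, Sum.elim_inr, rPow_succ, r_add_three (by decide)]
  refine ⟨⟨transform p, Φ, fun Θ => ?_, fun Θ => ?_⟩,
    ⟨smooth_transform p, hΦs, fun _ => rfl, fun i Θ a => ?_⟩, fun _ => rfl⟩
  · refine triangular_unique hk (hΦ (transform p Θ)) ?_
    rintro (a | n)
    · simp [e, k, transform, base]
    · simp only [e, k, Sum.elim_inr]
      rw [hinr, inv_mul_cancel_left₀ hp', sub_add_cancel]
  · funext a
    rcases a with a | n
    · exact (hΦ Θ (.inl a)).trans (by simp [e, k])
    · rw [hinr, hΦ Θ (.inr n)]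
      simp only [e, k, Sum.elim_inr]
      rw [add_sub_cancel_right, mul_inv_cancel_left₀ hp']
  · rcases a with a | n
    · exact act_coord _ _ _
    · have h3 : firstNonlocal p = 3 := if_neg hp
      fin_cases i
      · refine (act_rPow hp (n + 3) Θ).1.trans ?_
        simp [NonlocalSystem.liftD, rho, h3]
      · refine (act_rPow hp (n + 3) Θ).2.trans ?_
        simp [NonlocalSystem.liftD, rho, h3]

/-- All the coverings `ρ^p` are equivalent to `ρ^{-3}`. -/
theorem exists_globalEquiv_rho (p : ℤ) : ∃ G : Total ≃ Total, GlobalEquiv (rho (-3)) (rho p) G := by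
  by_cases hp : p = -2
  · rw [hp, rho_neg_two]
    exact (exists_globalEquiv (by decide)).imp fun _ h => h.1
  · exact (exists_globalEquiv hp).imp fun _ h => h.1

end Transformation

end RdDym

end

theorem mainTheorem4 :
    -- every `ρ^p` is a covering, and the functions `r^p_i` satisfy its defining equations
    (∀ p : ℤ, (RdDym.rho p).IsCovering RdDym.rdEq ∧
      ∀ (k : ℕ) (Θ : RdDym.Total),
        RdDym.act ((RdDym.rho p).liftD 0) (RdDym.r p k) Θ = (RdDym.rDer p k Θ).1 ∧
        RdDym.act ((RdDym.rho p).liftD 1) (RdDym.r p k) Θ = (RdDym.rDer p k Θ).2) ∧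
    -- the coverings are pairwise equivalent
    (∀ p q : ℤ, RdDym.Equivalent RdDym.rdEq (RdDym.rho p) (RdDym.rho q)) ∧
    -- for `p ≠ -2` the formula `r^p_i = -(p+2) (r^{-3}_i - (p+3) d_i)`, `i = m - 1 ≥ -1`,
    -- defines an equivalence from `ρ^{-3}` to `ρ^p`
    (∀ p : ℤ, p ≠ -2 →
      ∃ F : RdDym.overSpace RdDym.rdEq ≃ RdDym.overSpace RdDym.rdEq,
        RdDym.IsEquivalence RdDym.rdEq (RdDym.rho (-3)) (RdDym.rho p) F ∧
        ∀ (Θ : RdDym.overSpace RdDym.rdEq) (m : ℕ),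
          RdDym.r p (m + 1) (F Θ) =
            -((p : ℝ) + 2) * (RdDym.r (-3) (m + 1) Θ - ((p : ℝ) + 3) * RdDym.d p m Θ)) ∧
    -- `ρ^{-2}` coincides with `ρ^{-1}`
    (RdDym.rho (-2) = RdDym.rho (-1) ∧
      ∀ k : ℕ, RdDym.r (-2) (k + 1) = RdDym.r (-1) k) := by
  refine ⟨fun p => ⟨RdDym.isCovering_rho p, RdDym.act_r p⟩, fun p q => ?_, fun p hp => ?_,
    RdDym.rho_neg_two, RdDym.r_neg_two_succ⟩
  · obtain ⟨G, hG⟩ := RdDym.exists_globalEquiv_rho p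
    obtain ⟨G', hG'⟩ := RdDym.exists_globalEquiv_rho q
    exact (hG.symm.trans hG').equivalent
  · obtain ⟨G, hG, hGp⟩ := RdDym.exists_globalEquiv hp
    refine ⟨_, hG.isEquivalence, fun Θ m => ?_⟩
    rw [← RdDym.rPow_succ, ← RdDym.r_transform hp, ← hGp]
    rfl
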